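/- For a finite set $C\subset\mathbb Z^d$ let $\Theta_d(C)=\{(x,y)\in\mathbb Z^d\times\mathbb Z^d : |x-y|=1,\ x\in C,\ y\notin C\}$ be its edge boundary, where $|\cdot|$ is the Euclidean norm. For $n\in\mathbb N$ let $EIP^d(n)=\min\{\#\Theta_d(C) : C\subset\mathbb Z^d,\ \#C=n\}$. A nonempty finite set $C\subset\mathbb Z^d$ is called an $EIP^d$ minimizer if $\#\Theta_d(C)=EIP^d(\#C)$; by convention the empty set is also an $EIP^d$ minimizer. Let $d\ge 2$ and $j\in\{0,\dots,d-1\}$ be integers, and let $\ell,p\in\mathbb N$ satisfy $2p<\ell$ and $$2p\ \ge\ 4^{\,c_d}\,h_{\ell,d},\qquad\text{where } c_d=1-2^{1-d}\ \text{ and }\ h_{\ell,d}=\ell^{\,2^{1-d}}.$$ Then the box $$\{1,\dots,\ell-2p\}\times\{1,\dots,\ell+1\}^{j}\times\{1,\dots,\ell\}^{d-1-j}\subset\mathbb Z^d$$ is not an $EIP^d$ minimizer. -/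

import Mathlib

namespace EIP

/-- The edge boundary `Θ_d(C)`: ordered pairs `(x, y)` of points of `ℤ^d` at Euclidean distance `1`
with `x ∈ C` and `y ∉ C`. For integer points, `|x - y| = 1` is `∑ i, (x i - y i) ^ 2 = 1`. -/
def edgeBoundary {d : ℕ} (C : Finset (Fin d → ℤ)) : Set ((Fin d → ℤ) × (Fin d → ℤ)) :=
  {z | ∑ i, (z.1 i - z.2 i) ^ 2 = 1 ∧ z.1 ∈ C ∧ z.2 ∉ C}

/-- The edge perimeter `#Θ_d(C)`. The edge boundary of a finite set is finite, so `ncard` is its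
true cardinality. -/
noncomputable def edgePerimeter {d : ℕ} (C : Finset (Fin d → ℤ)) : ℕ :=
  (edgeBoundary C).ncard

/-- `EIP^d(n)`: the minimum of the edge perimeter over all sets of `n` points of `ℤ^d`. -/
noncomputable def minPerimeter (d n : ℕ) : ℕ :=
  sInf {m | ∃ C : Finset (Fin d → ℤ), C.card = n ∧ edgePerimeter C = m}

/-- `C` is an `EIP^d` minimizer. The empty set is one by convention. -/
def IsMinimizer {d : ℕ} (C : Finset (Fin d → ℤ)) : Prop :=
  C = ∅ ∨ edgePerimeter C = minPerimeter d C.card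

/-- The box `{1, …, ℓ - q} × {1, …, ℓ + 1}^j × {1, …, ℓ}^(d - 1 - j)` in `ℤ^d` (with `j ≤ d - 1`);
the coordinates are numbered from `0`. -/
noncomputable def box (ℓ j d q : ℕ) : Finset (Fin d → ℤ) :=
  Fintype.piFinset fun i : Fin d =>
    if i.val = 0 then Finset.Icc 1 ((ℓ : ℤ) - (q : ℤ))
    else if i.val ≤ j then Finset.Icc 1 ((ℓ : ℤ) + 1)
    else Finset.Icc 1 (ℓ : ℤ)

/-- The scaling parameter `h_{ℓ,d} = ℓ ^ (2 ^ (1 - d))`. -/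
noncomputable def scale (ℓ d : ℕ) : ℝ :=
  (ℓ : ℝ) ^ ((2 : ℝ) ^ (1 - (d : ℝ)))

/-- The exponent `c_d = 1 - 2 ^ (1 - d)`. -/
noncomputable def cexp (d : ℕ) : ℝ :=
  1 - (2 : ℝ) ^ (1 - (d : ℝ))

end EIP

/-!
Counting edges direction by direction, a box with sides `a, b, m₁, …, mₙ` has perimeter
`2 (a + b) R + a b P`, where `R` and `P` are the volume and the perimeter of `∏ {1, …, mᵢ}`.
So balance the two sides `a ≪ b` to `u × v` with `u + v = a + b` and `v = ⌈(a + b) / 2⌉`, and fill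
the new box layer by layer with the original number of points. If fewer than `u` layers suffice,
the perimeter drops. Otherwise it stays the same and the top layer is a box with sides
`c, m₁, …, mₙ`, where `v - c = u v - a b ≈ (b - a)² / 4`. By induction on the dimension this top
layer can be exchanged for a better set: for the defects `q = ℓ - a` and `q' = ℓ - c` one has
`q' ≥ q² / 4`, which turns the hypothesis `q ≥ 4 (ℓ / 4) ^ (2 ^ (1 - d))` into the corresponding one
for `q'` in dimension `d - 1`. In dimension `1` it reads `q ≥ ℓ`, which is impossible.
-/

namespace EIP

open Finset

/-- The points of `C` from which the step `v` leads out of `C`. For a unit vector `v` these are the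
edges of the boundary of `C` in direction `v`. -/
def exposed {G : Type*} [AddGroup G] [DecidableEq G] (C : Finset G) (v : G) : Finset G :=
  {x ∈ C | x + v ∉ C}

theorem mem_exposed {G : Type*} [AddGroup G] [DecidableEq G] {C : Finset G} {v x : G} :
    x ∈ exposed C v ↔ x ∈ C ∧ x + v ∉ C :=
  mem_filter

theorem card_exposed_neg {G : Type*} [AddGroup G] [DecidableEq G] (C : Finset G) (v : G) :
    #(exposed C (-v)) = #(exposed C v) := by
  have hstay : #{x ∈ C | x + -v ∈ C} = #{x ∈ C | x + v ∈ C} := by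
    refine card_nbij' (· + -v) (· + v) ?_ ?_ ?_ ?_ <;> intro x <;> simp +contextual
  have hneg := C.card_filter_add_card_filter_not (· + -v ∈ C)
  have hpos := C.card_filter_add_card_filter_not (· + v ∈ C)
  unfold exposed
  omega

theorem sum_sq_eq_one_iff {ι : Type*} [Fintype ι] [DecidableEq ι] {z : ι → ℤ} :
    ∑ i, z i ^ 2 = 1 ↔ ∃ i, ∃ ε : ℤˣ, z = Pi.single i (ε : ℤ) := by
  constructor
  · intro h
    obtain ⟨i, -, hi⟩ : ∃ i ∈ univ, z i ^ 2 ≠ 0 := exists_ne_zero_of_sum_ne_zero (by simp [h])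
    rw [← add_sum_erase _ _ (mem_univ i)] at h
    have hnonneg : ∀ k ∈ univ.erase i, 0 ≤ z k ^ 2 := fun k _ => sq_nonneg (z k)
    have hpos : 0 < z i ^ 2 := (sq_nonneg _).lt_of_ne' hi
    have hrest := (sum_eq_zero_iff_of_nonneg hnonneg).1 (by linarith [sum_nonneg hnonneg])
    have hone : z i ^ 2 = 1 := by linarith [sum_nonneg hnonneg]
    refine ⟨i, Units.ofPowEqOne (z i) 2 hone two_ne_zero, funext fun k => ?_⟩
    obtain rfl | hk := eq_or_ne k i
    · simp
    · simpa [hk] using hrest k (by simp [hk])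
  · rintro ⟨i, ε, rfl⟩
    simp [Pi.single_apply, ite_pow, ← Units.val_pow_eq_pow_val]

theorem single_units_injective {ι R : Type*} [DecidableEq ι] [MonoidWithZero R] [Nontrivial R] :
    Function.Injective fun p : ι × Rˣ => (Pi.single p.1 (p.2 : R) : ι → R) := by
  rintro ⟨i, ε⟩ ⟨k, δ⟩ h
  have hi := congrFun h i
  obtain rfl | hik := eq_or_ne i k
  · simpa [Units.val_inj] using hi
  · simp [hik] at hi

theorem edgePerimeter_eq_sum {d : ℕ} (C : Finset (Fin d → ℤ)) :
    edgePerimeter C = 2 * ∑ i, #(exposed C (Pi.single i (-1))) := by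
  let S := univ.sigma fun p : Fin d × ℤˣ => exposed C (Pi.single p.1 (p.2 : ℤ))
  let f : (Σ _ : Fin d × ℤˣ, Fin d → ℤ) → (Fin d → ℤ) × (Fin d → ℤ) :=
    fun e => (e.2, e.2 + Pi.single e.1.1 (e.1.2 : ℤ))
  have himage : edgeBoundary C = f '' S := by
    ext ⟨x, y⟩
    have hunit : ∑ i, (x i - y i) ^ 2 = 1 ↔ ∃ i, ∃ ε : ℤˣ, y = x + Pi.single i (ε : ℤ) := by
      rw [sum_congr rfl fun i _ => sub_sq_comm (x i) (y i)]
      simp only [← Pi.sub_apply, sum_sq_eq_one_iff, sub_eq_iff_eq_add']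
    simp only [edgeBoundary, Set.mem_ofPred_eq, hunit]
    constructor
    · rintro ⟨⟨i, ε, rfl⟩, hx, hy⟩
      exact ⟨⟨(i, ε), x⟩, by simp [S, mem_exposed, hx, hy], rfl⟩
    · rintro ⟨⟨⟨i, ε⟩, x⟩, he, hxy⟩
      obtain ⟨rfl, rfl⟩ := Prod.mk.inj hxy
      exact ⟨⟨i, ε, rfl⟩, mem_exposed.1 (mem_sigma.1 he).2⟩
  have hinj : Function.Injective f := by
    rintro ⟨p, x⟩ ⟨p', x'⟩ h
    obtain ⟨hx : x = x', hstep⟩ := Prod.mk.inj h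
    subst hx
    obtain rfl := single_units_injective (add_left_cancel hstep)
    rfl
  have hflip (i : Fin d) : #(exposed C (Pi.single i 1)) = #(exposed C (Pi.single i (-1))) := by
    rw [Pi.single_neg, card_exposed_neg]
  rw [edgePerimeter, himage, Set.ncard_image_of_injective _ hinj, Set.ncard_coe_finset,
    card_sigma, Fintype.sum_prod_type, mul_sum]
  refine sum_congr rfl fun i _ => ?_
  rw [UnitsInt.univ, sum_pair (by decide), Units.val_one, Units.val_neg, Units.val_one, hflip,
    two_mul]

theorem edgePerimeter_empty {d : ℕ} : edgePerimeter (∅ : Finset (Fin d → ℤ)) = 0 := by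
  simp [edgePerimeter, edgeBoundary]

/-- `C` is improvable in `K` if some subset of `K` with as many points as `C` has a smaller edge
perimeter. The container `K` is what allows an improved layer to be put on top of another one. -/
def IsImprovableIn {d : ℕ} (C K : Finset (Fin d → ℤ)) : Prop :=
  ∃ D ⊆ K, #D = #C ∧ edgePerimeter D < edgePerimeter C

theorem IsImprovableIn.mono {d : ℕ} {C K L : Finset (Fin d → ℤ)} (h : IsImprovableIn C K)
    (hKL : K ⊆ L) : IsImprovableIn C L :=
  let ⟨D, hDK, hD⟩ := h
  ⟨D, hDK.trans hKL, hD⟩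

theorem IsImprovableIn.not_isMinimizer {d : ℕ} {C K : Finset (Fin d → ℤ)}
    (h : IsImprovableIn C K) : ¬ IsMinimizer C := by
  obtain ⟨D, -, hcard, hlt⟩ := h
  rintro (rfl | hmin)
  · simp [edgePerimeter_empty] at hlt
  · have hle : minPerimeter d #C ≤ edgePerimeter D := Nat.sInf_le ⟨D, hcard, rfl⟩
    exact (hmin ▸ hle).not_gt hlt

section Stack

variable {n m : ℕ} {A B : Finset (Fin n → ℤ)}

theorem cons_add_single_zero (x v : ℤ) (y : Fin n → ℤ) :
    (Fin.cons x y + Pi.single 0 v : Fin (n + 1) → ℤ) = Fin.cons (x + v) y := by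
  ext i
  cases i using Fin.cases <;> simp

theorem cons_add_single_succ (x v : ℤ) (y : Fin n → ℤ) (i : Fin n) :
    (Fin.cons x y + Pi.single i.succ v : Fin (n + 1) → ℤ) = Fin.cons x (y + Pi.single i v) := by
  ext k
  cases k using Fin.cases <;> simp [Pi.single_apply]

/-- The set made of the layers `A` at heights `1, …, m` and the layer `B` at height `m + 1`, the
height being the first coordinate. -/
noncomputable def stack (m : ℕ) (A B : Finset (Fin n → ℤ)) : Finset (Fin (n + 1) → ℤ) :=
  (Icc (1 : ℤ) m ×ˢ A ∪ {(m : ℤ) + 1} ×ˢ B).map (Fin.consEquiv fun _ => ℤ).toEmbedding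

theorem cons_mem_stack {x : ℤ} {y : Fin n → ℤ} :
    (Fin.cons x y : Fin (n + 1) → ℤ) ∈ stack m A B ↔
      (1 ≤ x ∧ x ≤ m) ∧ y ∈ A ∨ x = m + 1 ∧ y ∈ B := by
  have hcons : (Fin.cons x y : Fin (n + 1) → ℤ) = (Fin.consEquiv fun _ => ℤ).toEmbedding (x, y) :=
    rfl
  rw [stack, hcons, mem_map']
  simp only [mem_union, mem_product, mem_Icc, mem_singleton]

theorem card_stack (m : ℕ) (A B : Finset (Fin n → ℤ)) : #(stack m A B) = m * #A + #B := by
  rw [stack, card_map, card_union_of_disjoint]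
  · simp
  · exact disjoint_product.2 (.inl (by simp))

theorem exposed_stack_succ (m : ℕ) (A B : Finset (Fin n → ℤ)) (i : Fin n) (v : ℤ) :
    exposed (stack m A B) (Pi.single i.succ v) =
      stack m (exposed A (Pi.single i v)) (exposed B (Pi.single i v)) := by
  ext z
  cases z using Fin.consCases with | cons x y =>
  simp only [mem_exposed, cons_add_single_succ, cons_mem_stack]
  grind

theorem exposed_stack_zero (hm : m ≠ 0) (hBA : B ⊆ A) :
    exposed (stack m A B) (Pi.single 0 (-1)) = stack 1 A ∅ := by
  ext z
  cases z using Fin.consCases with | cons x y =>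
  have := @hBA y
  simp only [mem_exposed, cons_add_single_zero, cons_mem_stack, notMem_empty]
  grind

theorem edgePerimeter_stack (hm : m ≠ 0) (hBA : B ⊆ A) :
    edgePerimeter (stack m A B) = 2 * #A + m * edgePerimeter A + edgePerimeter B := by
  simp only [edgePerimeter_eq_sum, Fin.sum_univ_succ, exposed_stack_zero hm hBA,
    exposed_stack_succ, card_stack, sum_add_distrib, ← mul_sum, card_empty]
  ring

end Stack

section Cuboid

variable {n : ℕ}

/-- The box `∏ i, {1, …, m i}`. -/
noncomputable def cuboid (m : Fin n → ℕ) : Finset (Fin n → ℤ) :=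
  Fintype.piFinset fun i => Icc (1 : ℤ) (m i)

theorem card_cuboid_pos {m : Fin n → ℕ} (hm : ∀ i, m i ≠ 0) : 0 < #(cuboid m) := by
  simpa [cuboid, Nat.pos_iff_ne_zero, prod_eq_zero_iff] using hm

theorem cons_mem_cuboid {a : ℕ} {m : Fin n → ℕ} {x : ℤ} {y : Fin n → ℤ} :
    (Fin.cons x y : Fin (n + 1) → ℤ) ∈ cuboid (Fin.cons a m : Fin (n + 1) → ℕ) ↔
      (1 ≤ x ∧ x ≤ a) ∧ y ∈ cuboid m := by
  simp [cuboid, Fin.forall_fin_succ]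

theorem cuboid_cons_mono {a b : ℕ} (hab : a ≤ b) (m : Fin n → ℕ) :
    cuboid (Fin.cons a m : Fin (n + 1) → ℕ) ⊆ cuboid (Fin.cons b m : Fin (n + 1) → ℕ) := by
  refine Fintype.piFinset_subset _ _ fun i => Icc_subset_Icc_right ?_
  cases i using Fin.cases <;> simp [hab]

theorem cuboid_cons (a : ℕ) (m : Fin n → ℕ) :
    cuboid (Fin.cons a m : Fin (n + 1) → ℕ) = stack a (cuboid m) ∅ := by
  ext z
  cases z using Fin.consCases with | cons x y =>
  simp [cons_mem_cuboid, cons_mem_stack]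

theorem stack_subset_cuboid {w u : ℕ} {m : Fin n → ℕ} {A B : Finset (Fin n → ℤ)} (hwu : w < u)
    (hA : A ⊆ cuboid m) (hB : B ⊆ cuboid m) :
    stack w A B ⊆ cuboid (Fin.cons u m : Fin (n + 1) → ℕ) := by
  intro z
  cases z using Fin.consCases with | cons x y =>
  have := @hA y
  have := @hB y
  simp only [cons_mem_stack, cons_mem_cuboid]
  grind

theorem card_cuboid_cons (a : ℕ) (m : Fin n → ℕ) :
    #(cuboid (Fin.cons a m : Fin (n + 1) → ℕ)) = a * #(cuboid m) := by
  rw [cuboid_cons, card_stack, card_empty, add_zero]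

theorem edgePerimeter_cuboid_cons {a : ℕ} (ha : a ≠ 0) (m : Fin n → ℕ) :
    edgePerimeter (cuboid (Fin.cons a m : Fin (n + 1) → ℕ)) =
      2 * #(cuboid m) + a * edgePerimeter (cuboid m) := by
  rw [cuboid_cons, edgePerimeter_stack ha (empty_subset _), edgePerimeter_empty, add_zero]

theorem box_eq_cuboid {ℓ j q : ℕ} (hq : q ≤ ℓ) :
    box ℓ j (n + 1) q = cuboid (Fin.cons (ℓ - q)
      (fun i : Fin n => if i.val + 1 ≤ j then ℓ + 1 else ℓ) : Fin (n + 1) → ℕ) := by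
  unfold box cuboid
  congr! 2 with i
  cases i using Fin.cases with
  | zero => simp [Nat.cast_sub hq]
  | succ i => by_cases h : i.val < j <;> simp [h]

end Cuboid

section Layers

variable {n a b c v w : ℕ} {m : Fin n → ℕ}

theorem isImprovableIn_cuboid_of_top_layer {B : Finset (Fin (n + 1) → ℤ)} (ha : a ≠ 0)
    (hc : c ≠ 0) (hv : v ≠ 0) (hw : w ≠ 0) (hvb : v ≤ b) (hvol : w * v + c = a * b)
    (hBv : B ⊆ cuboid (Fin.cons v m : Fin (n + 1) → ℕ))
    (hBcard : #B = #(cuboid (Fin.cons c m : Fin (n + 1) → ℕ)))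
    (hlt : 2 * (w + 1 + v) * #(cuboid m) + edgePerimeter B <
      2 * (a + b) * #(cuboid m) + edgePerimeter (cuboid (Fin.cons c m : Fin (n + 1) → ℕ))) :
    IsImprovableIn (cuboid (Fin.cons a (Fin.cons b m : Fin (n + 1) → ℕ) : Fin (n + 2) → ℕ))
      (cuboid (Fin.cons (w + 1) (Fin.cons b m : Fin (n + 1) → ℕ) : Fin (n + 2) → ℕ)) := by
  have hlayer := cuboid_cons_mono hvb m
  have hb : b ≠ 0 := by omega
  refine ⟨stack w (cuboid (Fin.cons v m : Fin (n + 1) → ℕ)) B,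
    stack_subset_cuboid w.lt_succ_self hlayer (hBv.trans hlayer), ?_, ?_⟩
  · simp only [card_stack, card_cuboid_cons, hBcard, ← mul_assoc, ← add_mul, hvol]
  · rw [edgePerimeter_stack hw hBv]
    simp only [edgePerimeter_cuboid_cons, card_cuboid_cons, ne_eq, ha, hb, hc, hv,
      not_false_eq_true] at hlt ⊢
    linear_combination hlt + edgePerimeter (cuboid m) * hvol

theorem isImprovableIn_cuboid_of_few_layers (hm : ∀ i, m i ≠ 0) (ha : a ≠ 0) (hc : c ≠ 0)
    (hw : w ≠ 0) (hcv : c ≤ v) (hvb : v ≤ b) (hvol : w * v + c = a * b)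
    (hfew : w + 1 + v < a + b) :
    IsImprovableIn (cuboid (Fin.cons a (Fin.cons b m : Fin (n + 1) → ℕ) : Fin (n + 2) → ℕ))
      (cuboid (Fin.cons (w + 1) (Fin.cons b m : Fin (n + 1) → ℕ) : Fin (n + 2) → ℕ)) := by
  have hR := card_cuboid_pos hm
  refine isImprovableIn_cuboid_of_top_layer ha hc (by omega) hw hvb hvol
    (cuboid_cons_mono hcv m) rfl ?_
  gcongr

theorem isImprovableIn_cuboid_of_full_layers (ha : a ≠ 0) (hc : c ≠ 0) (hv : v ≠ 0) (hw : w ≠ 0)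
    (hvb : v ≤ b) (hvol : w * v + c = a * b) (hfull : w + 1 + v = a + b)
    (htop : IsImprovableIn (cuboid (Fin.cons c m : Fin (n + 1) → ℕ))
      (cuboid (Fin.cons v m : Fin (n + 1) → ℕ))) :
    IsImprovableIn (cuboid (Fin.cons a (Fin.cons b m : Fin (n + 1) → ℕ) : Fin (n + 2) → ℕ))
      (cuboid (Fin.cons (w + 1) (Fin.cons b m : Fin (n + 1) → ℕ) : Fin (n + 2) → ℕ)) := by
  obtain ⟨B, hBv, hBcard, hlt⟩ := htop
  refine isImprovableIn_cuboid_of_top_layer ha hc hv hw hvb hvol hBv hBcard ?_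
  rw [hfull]
  gcongr

theorem exists_layers {N u : ℕ} (hvN : v < N) (hN : N ≤ u * v) :
    ∃ w c, w * v + c = N ∧ w ≠ 0 ∧ c ≠ 0 ∧ c ≤ v ∧ w < u := by
  have hv : 0 < v := Nat.pos_of_mul_pos_left (by omega : 0 < u * v)
  refine ⟨(N - 1) / v, (N - 1) % v + 1, ?_, ?_, by omega, ?_, ?_⟩
  · have := Nat.div_add_mod' (N - 1) v
    omega
  · exact (Nat.div_pos (by omega) hv).ne'
  · exact Nat.mod_lt _ hv
  · exact (Nat.div_lt_iff_lt_mul hv).2 (by omega)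

end Layers

section Balancing

variable {n ℓ q : ℕ}

theorem two_le_of_four_pow_mul_le (hℓ : ℓ ≠ 0)
    (h : 4 ^ 2 ^ (n + 1) * ℓ ≤ 4 * q ^ 2 ^ (n + 1)) : 2 ≤ q := by
  by_contra! hq
  have hq_pow : q ^ 2 ^ (n + 1) ≤ 1 := pow_le_one₀ q.zero_le (by omega)
  have hfour : 4 ^ 2 ≤ 4 ^ 2 ^ (n + 1) :=
    Nat.pow_le_pow_right (by norm_num) (Nat.le_self_pow n.succ_ne_zero 2)
  nlinarith [Nat.one_le_iff_ne_zero.2 hℓ]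

theorem four_pow_mul_le_of_sq_le {r : ℕ} (hqr : q ^ 2 ≤ 4 * r)
    (h : 4 ^ 2 ^ (n + 1) * ℓ ≤ 4 * q ^ 2 ^ (n + 1)) : 4 ^ 2 ^ n * ℓ ≤ 4 * r ^ 2 ^ n := by
  refine Nat.le_of_mul_le_mul_left (c := 4 ^ 2 ^ n) ?_ (by positivity)
  calc 4 ^ 2 ^ n * (4 ^ 2 ^ n * ℓ) = 4 ^ 2 ^ (n + 1) * ℓ := by ring
    _ ≤ 4 * q ^ 2 ^ (n + 1) := h
    _ = 4 * (q ^ 2) ^ 2 ^ n := by rw [← pow_mul, pow_succ']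
    _ ≤ 4 * (4 * r) ^ 2 ^ n := by gcongr
    _ = 4 ^ 2 ^ n * (4 * r ^ 2 ^ n) := by ring

/-- Balancing the sides `a` and `a + s + t` to `a + s` and `a + t` gains `s * t` points per unit
of volume of the remaining sides. This leaves a top layer of short side `c = a + t - s * t`, so the
right-hand side is `4 * (ℓ - c + t)` for `ℓ = a + q`. -/
theorem sq_add_four_mul_le {s t : ℕ} (hs : 1 ≤ s) (hst : s ≤ t) (hts : t ≤ s + 1)
    (hq : q = s + t ∨ q + 1 = s + t) : q ^ 2 + 4 * t ≤ 4 * (q + s * t) := by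
  obtain rfl | rfl : t = s ∨ t = s + 1 := by omega
  all_goals obtain rfl | hq := hq <;> nlinarith

theorem isImprovableIn_cuboid_cons {a : ℕ} {m : Fin n → ℕ} (ha : a ≠ 0) (haℓ : a ≤ ℓ)
    (hm : ∀ i, m i = ℓ ∨ m i = ℓ + 1) (hdefect : 4 ^ 2 ^ n * ℓ ≤ 4 * (ℓ - a) ^ 2 ^ n) :
    IsImprovableIn (cuboid (Fin.cons a m : Fin (n + 1) → ℕ))
      (cuboid (Fin.cons ((a + ℓ + 1) / 2) m : Fin (n + 1) → ℕ)) := by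
  induction n generalizing a with
  | zero =>
    rw [pow_zero, pow_one, pow_one] at hdefect
    omega
  | succ n ih =>
    cases m using Fin.consCases with | cons b m =>
    have hb : b = ℓ ∨ b = ℓ + 1 := hm 0
    replace hm : ∀ i, m i = ℓ ∨ m i = ℓ + 1 := fun i => hm i.succ
    have hgap : 2 ≤ ℓ - a := two_le_of_four_pow_mul_le (by omega) hdefect
    obtain ⟨s, t, rfl, hs, hst, hts⟩ : ∃ s t, b = a + s + t ∧ 1 ≤ s ∧ s ≤ t ∧ t ≤ s + 1 :=
      ⟨(b - a) / 2, b - a - (b - a) / 2, by omega, by omega, by omega, by omega⟩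
    have hgain : (a + s) * (a + t) = a * (a + s + t) + s * t := by ring
    have hlayer : a + t < a * (a + s + t) :=
      (by omega : a + t < a + s + t).trans_le (Nat.le_mul_of_pos_left _ (by omega))
    obtain ⟨w, c, hvol, hw, hc, hcv, hwu⟩ := exists_layers (u := a + s) hlayer (by omega)
    refine IsImprovableIn.mono ?_ (cuboid_cons_mono (by omega : w + 1 ≤ _) _)
    obtain hfew | hfull : w + 1 < a + s ∨ w + 1 = a + s := by omega
    · exact isImprovableIn_cuboid_of_few_layers (fun i => by have := hm i; omega) ha hc hw hcv
        (by omega) hvol (by omega)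
    · have hcut : c + s * t = a + t := by
        linear_combination hvol + hgain.symm + (a + t) * hfull.symm
      have hdefect_sq : (ℓ - a) ^ 2 ≤ 4 * (ℓ - c) := by
        have := sq_add_four_mul_le (q := ℓ - a) hs hst hts (by omega)
        omega
      have hfit : (c + ℓ + 1) / 2 ≤ a + t := by
        have := Nat.le_mul_of_pos_right s (hs.trans hst)
        omega
      have htop := ih hc (by omega) hm (four_pow_mul_le_of_sq_le hdefect_sq hdefect)
      exact isImprovableIn_cuboid_of_full_layers ha hc (by omega) hw (by omega) hvol (by omega)
        (htop.mono (cuboid_cons_mono hfit m))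

theorem four_pow_mul_le_of_scale_le
    (h : (4 : ℝ) ^ cexp (n + 1) * scale ℓ (n + 1) ≤ q) : 4 ^ 2 ^ n * ℓ ≤ 4 * q ^ 2 ^ n := by
  have hexp : (2 : ℝ) ^ (1 - ((n + 1 : ℕ) : ℝ)) = ((2 ^ n : ℕ) : ℝ)⁻¹ := by
    rw [show 1 - ((n + 1 : ℕ) : ℝ) = -n by push_cast; ring, Real.rpow_neg zero_le_two,
      Real.rpow_natCast, Nat.cast_pow, Nat.cast_ofNat]
  have hpos : (2 ^ n : ℕ) ≠ 0 := by positivity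
  have hfour : ((4 : ℝ) ^ cexp (n + 1)) ^ 2 ^ n = 4 ^ 2 ^ n / 4 := by
    rw [cexp, hexp, Real.rpow_sub (by norm_num), Real.rpow_one, div_pow,
      Real.rpow_inv_natCast_pow (by norm_num) hpos]
  have hscale : scale ℓ (n + 1) ^ 2 ^ n = ℓ := by
    rw [scale, hexp, Real.rpow_inv_natCast_pow ℓ.cast_nonneg hpos]
  have hpow : (4 : ℝ) ^ 2 ^ n / 4 * ℓ ≤ (q : ℝ) ^ 2 ^ n := by
    rw [← hfour, ← hscale, ← mul_pow]
    gcongr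
    unfold scale
    positivity
  have : (4 : ℝ) ^ 2 ^ n * ℓ ≤ 4 * (q : ℝ) ^ 2 ^ n := by linarith
  exact_mod_cast this

end Balancing

end EIP

theorem lemma3p6_general (d ℓ j q : ℕ) (hd : 1 ≤ d) (hq : q < ℓ)
    (hscale : (4 : ℝ) ^ EIP.cexp d * EIP.scale ℓ d ≤ q) :
    ¬ EIP.IsMinimizer (EIP.box ℓ j d q) := by
  obtain ⟨n, rfl⟩ := Nat.exists_eq_add_of_le' hd
  rw [EIP.box_eq_cuboid hq.le]
  refine (EIP.isImprovableIn_cuboid_cons (by omega) (Nat.sub_le ℓ q)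
    (fun i => (ite_eq_or_eq _ _ _).symm) ?_).not_isMinimizer
  rw [Nat.sub_sub_self hq.le]
  exact EIP.four_pow_mul_le_of_scale_le hscale

theorem lemma3p6 (d ℓ j p : ℕ) (hd : 2 ≤ d) (hj : j ≤ d - 1)
    (hne : 2 * p < ℓ)
    (hp : (4 : ℝ) ^ EIP.cexp d * EIP.scale ℓ d ≤ 2 * (p : ℝ)) :
    ¬ EIP.IsMinimizer (EIP.box ℓ j d (2 * p)) :=
  lemma3p6_general d ℓ j (2 * p) (by omega) hne (by exact_mod_cast hp)
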